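/- Let $H$ be a complex, separable, infinite-dimensional Hilbert space and let $T$ be a bounded linear operator on $H$. Let $\rho_\ell(T)$ be the set of all $\lambda\in\mathbb C$ for which there is a bounded operator $S$ on $H$ with $S(\lambda I-T)=I$, and let $\sigma(T)$ be the spectrum of $T$. Let $\Omega\subseteq\rho_\ell(T)\cap\sigma(T)$ be open and connected (hence non-empty), and let $L:\Omega\to L(H)$ be an analytic function with values in the bounded operators on $H$ such that $L(\lambda)(\lambda I-T)=I$ for all $\lambda\in\Omega$. Then there exist a complex Hilbert space $H'$ and a family of bounded operators $\tilde T(\lambda)$, $\lambda\in\Omega$, on the Hilbert space direct sum $\tilde H=H\oplus H'$ such that: 1. $\tilde T(\lambda)$ extends $T$, i.e. $\tilde T(\lambda)(h,0)=(Th,0)$ for all $h\in H$ and all $\lambda\in\Omega$; 2. $\lambda I-\tilde T(\lambda)$ is invertible in $L(\tilde H)$ for all $\lambda\in\Omega$; 3. for every $\lambda\in\Omega$, with respect to the decomposition $\tilde H=H\oplus H'$, $$(\lambda I-\tilde T(\lambda))^{-1}=\begin{pmatrix}L(\lambda)&0\\ \ast&\ast\end{pmatrix}$$ for some bounded operators $\ast$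 from $H$ to $H'$ and from $H'$ to $H'$; 4. $\tilde T(\lambda)$ is independent of $\lambda\in\Omega$ if and only if $L$ is a left resolvent of $T$ on $\Omega$, that is, $L(\lambda)(\lambda I-T)=I$ for all $\lambda\in\Omega$ and $L(\lambda)-L(\mu)=(\mu-\lambda)L(\lambda)L(\mu)$ for all $\lambda,\mu$ in the same connected component of $\Omega$; 5. if the kernel $N(L(\lambda))$ is finite-dimensional for some $\lambda\in\Omega$, then the map $\lambda\mapsto\tilde T(\lambda)$ is analytic on $\Omega$. -/

import Mathlib

universe u

/-- The left resolvent set of `T`: all `z` such that `z I - T` has a left inverse in the algebra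
of bounded operators. -/
def leftResolventSet {H : Type u} [NormedAddCommGroup H] [InnerProductSpace ℂ H]
    (T : H →L[ℂ] H) : Set ℂ :=
  {z | ∃ S : H →L[ℂ] H, S * (z • (1 : H →L[ℂ] H) - T) = 1}

/-- `L` is a left inverse function of `z I - T` on `U`. -/
def IsLeftInverseOn {H : Type u} [NormedAddCommGroup H] [InnerProductSpace ℂ H]
    (T : H →L[ℂ] H) (U : Set ℂ) (L : ℂ → (H →L[ℂ] H)) : Prop :=
  ∀ z ∈ U, L z * (z • (1 : H →L[ℂ] H) - T) = 1

/-- `L` is a left resolvent of `T` on `U`: a left inverse function of `z I - T` on `U` that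
satisfies the resolvent equation at any two points of the same connected component of `U`. -/
def IsLeftResolventOn {H : Type u} [NormedAddCommGroup H] [InnerProductSpace ℂ H]
    (T : H →L[ℂ] H) (U : Set ℂ) (L : ℂ → (H →L[ℂ] H)) : Prop :=
  IsLeftInverseOn T U L ∧
    ∀ z ∈ U, ∀ w ∈ connectedComponentIn U z, L z - L w = (w - z) • (L z * L w)

/-- The Hilbert space direct sum `H ⊕ H'`. -/
abbrev HilbertSum (H H' : Type u) : Type u := WithLp 2 (H × H')

/-- The operator on `H ⊕ H'` with matrix `[[A, B], [C, D]]`, that is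
`(h, h') ↦ (A h + B h', C h + D h')`. -/
noncomputable def blockOperator {H H' : Type u} [NormedAddCommGroup H] [InnerProductSpace ℂ H]
    [NormedAddCommGroup H'] [InnerProductSpace ℂ H']
    (A : H →L[ℂ] H) (B : H' →L[ℂ] H) (C : H →L[ℂ] H') (D : H' →L[ℂ] H') :
    HilbertSum H H' →L[ℂ] HilbertSum H H' :=
  ((WithLp.prodContinuousLinearEquiv 2 ℂ H H').symm : (H × H') →L[ℂ] HilbertSum H H') ∘L
    ((A.coprod B).prod (C.coprod D)) ∘L
    (WithLp.prodContinuousLinearEquiv 2 ℂ H H' : HilbertSum H H' →L[ℂ] (H × H'))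

theorem blockOperator_apply {H H' : Type u} [NormedAddCommGroup H] [InnerProductSpace ℂ H]
    [NormedAddCommGroup H'] [InnerProductSpace ℂ H']
    (A : H →L[ℂ] H) (B : H' →L[ℂ] H) (C : H →L[ℂ] H') (D : H' →L[ℂ] H') (h : H) (h' : H') :
    blockOperator A B C D (WithLp.toLp 2 (h, h')) =
      WithLp.toLp 2 (A h + B h', C h + D h') := rfl

/-- The operator `S` on `H ⊕ H'` extends the operator `T` on `H`, where `h ∈ H` is identified
with `(h, 0)`. -/
def IsExtensionOf {H H' : Type u} [NormedAddCommGroup H] [InnerProductSpace ℂ H]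
    [NormedAddCommGroup H'] [InnerProductSpace ℂ H']
    (T : H →L[ℂ] H) (S : HilbertSum H H' →L[ℂ] HilbertSum H H') : Prop :=
  ∀ h : H, S (WithLp.toLp 2 (h, 0)) = WithLp.toLp 2 (T h, 0)

/-! If `L A = 1`, then `H` is the direct sum of the range of `A` and `ker L`. So `[[A, B], [0, D]]`
is invertible with inverse `[[L, 0], [*, *]]` once `D` has a right inverse killed by `B`, and `B`
maps `ker D` isomorphically onto `ker L`. Shifts on `ℓ²` provide such `D`. If `L` is a left
resolvent, all `ker (L z)` are one space `K`. The single corner `c S*` on `ℓ²(ℕ, K)`, with `S*` the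
backward shift and `c` large, then serves every `z`, so the extension is constant
(`isUnit_and_inverse_of_backwardShift`). Otherwise the kernel may move, and `D` is built on `ℓ²(ℕ,
H)` from the projection onto `ker (L z)`, analytically in `z` (`isUnit_and_inverse_of_complement`).
That family cannot be constant, since the corners of a genuine resolvent obey the resolvent equation
(`resolvent_equation_of_inverse_eq_blockOperator`). -/

open scoped lp ENNReal

/-! ### Algebra of block operators. -/

section BlockOperator

variable {H H' : Type u} [NormedAddCommGroup H] [InnerProductSpace ℂ H]
  [NormedAddCommGroup H'] [InnerProductSpace ℂ H']

theorem HilbertSum.clm_ext {M N : HilbertSum H H' →L[ℂ] HilbertSum H H'}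
    (h : ∀ (x : H) (y : H'), M (WithLp.toLp 2 (x, y)) = N (WithLp.toLp 2 (x, y))) : M = N := by
  refine ContinuousLinearMap.ext fun v => ?_
  exact h v.fst v.snd

theorem blockOperator_one : blockOperator (1 : H →L[ℂ] H) 0 0 (1 : H' →L[ℂ] H') = 1 := by
  refine HilbertSum.clm_ext fun x y => ?_
  simp [blockOperator_apply]

theorem blockOperator_mul (A₁ A₂ : H →L[ℂ] H) (B₁ B₂ : H' →L[ℂ] H) (C₁ C₂ : H →L[ℂ] H')
    (D₁ D₂ : H' →L[ℂ] H') :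
    blockOperator A₁ B₁ C₁ D₁ * blockOperator A₂ B₂ C₂ D₂ =
      blockOperator (A₁ * A₂ + B₁ ∘L C₂) (A₁ ∘L B₂ + B₁ ∘L D₂)
        (C₁ ∘L A₂ + D₁ ∘L C₂) (C₁ ∘L B₂ + D₁ * D₂) := by
  refine HilbertSum.clm_ext fun x y => ?_
  simp only [mul_apply_eq_comp, blockOperator_apply, map_add,
    add_apply, ContinuousLinearMap.comp_apply]
  congr 2 <;> abel

theorem smul_one_sub_blockOperator (z : ℂ) (A : H →L[ℂ] H) (B : H' →L[ℂ] H) (C : H →L[ℂ] H')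
    (D : H' →L[ℂ] H') :
    z • 1 - blockOperator A B C D = blockOperator (z • 1 - A) (-B) (-C) (z • 1 - D) := by
  refine HilbertSum.clm_ext fun x y => ?_
  simp only [sub_apply, smul_apply,
    one_apply_eq_self, blockOperator_apply, neg_apply]
  rw [← WithLp.toLp_smul, ← WithLp.toLp_sub]
  congr 1
  ext <;> simp <;> abel

theorem isExtensionOf_blockOperator (T : H →L[ℂ] H) (B : H' →L[ℂ] H) (D : H' →L[ℂ] H') :
    IsExtensionOf T (blockOperator T B 0 D) := fun h => by
  simp [blockOperator_apply]

/-- A block upper triangular operator `[[A, B], [0, D]]` with `L A = 1` has the inverse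
`[[L, 0], [C, R]]` as soon as `D` is right invertible by `R` and `B`, `C` match the kernel of `D`
with that of `L`. -/
theorem blockOperator_isUnit_and_inverse {A L : H →L[ℂ] H} {B : H' →L[ℂ] H} {C : H →L[ℂ] H'}
    {D R : H' →L[ℂ] H'} (hLA : L * A = 1) (hLB : L ∘L B = 0) (hCA : C ∘L A = 0)
    (hDC : D ∘L C = 0) (hBR : B ∘L R = 0) (hBC : A * L + B ∘L C = 1)
    (hDR : D * R = 1) (hRD : C ∘L B + R * D = 1) :
    IsUnit (blockOperator A B 0 D) ∧
      Ring.inverse (blockOperator A B 0 D) = blockOperator L 0 C R := by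
  let U : (HilbertSum H H' →L[ℂ] HilbertSum H H')ˣ :=
    { val := blockOperator A B 0 D
      inv := blockOperator L 0 C R
      val_inv := by
        rw [blockOperator_mul, ← blockOperator_one]
        simp [hBC, hBR, hDC, hDR]
      inv_val := by
        rw [blockOperator_mul, ← blockOperator_one]
        simp [hLA, hLB, hCA, hRD] }
  exact ⟨U.isUnit, Ring.inverse_unit U⟩

/-- Affine dependence on the right column, through fixed bounded maps, lets differentiability pass
from the entries to the block operator. -/
theorem exists_blockOperator_eq_add (A : H →L[ℂ] H) (C : H →L[ℂ] H') :
    ∃ (M : HilbertSum H H' →L[ℂ] HilbertSum H H') (i₁ : H →L[ℂ] HilbertSum H H')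
      (i₂ : H' →L[ℂ] HilbertSum H H') (p : HilbertSum H H' →L[ℂ] H'),
      ∀ B D, blockOperator A B C D = M + (i₁ ∘L B ∘L p + i₂ ∘L D ∘L p) := by
  refine ⟨blockOperator A 0 C 0,
    (WithLp.prodContinuousLinearEquiv 2 ℂ H H').symm.toContinuousLinearMap ∘L
      ContinuousLinearMap.inl ℂ H H',
    (WithLp.prodContinuousLinearEquiv 2 ℂ H H').symm.toContinuousLinearMap ∘L
      ContinuousLinearMap.inr ℂ H H',
    ContinuousLinearMap.snd ℂ H H' ∘L
      (WithLp.prodContinuousLinearEquiv 2 ℂ H H').toContinuousLinearMap, fun B D => ?_⟩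
  refine HilbertSum.clm_ext fun x y => ?_
  simp only [add_apply, blockOperator_apply]
  change _ = _ + (WithLp.toLp 2 (B y, 0) + WithLp.toLp 2 (0, D y))
  rw [← WithLp.toLp_add, ← WithLp.toLp_add]
  simp

theorem DifferentiableAt.blockOperator {A : H →L[ℂ] H} {C : H →L[ℂ] H'} {B : ℂ → H' →L[ℂ] H}
    {D : ℂ → H' →L[ℂ] H'} {z : ℂ} (hB : DifferentiableAt ℂ B z) (hD : DifferentiableAt ℂ D z) :
    DifferentiableAt ℂ (fun z => blockOperator A (B z) C (D z)) z := by
  obtain ⟨M, i₁, i₂, p, h⟩ := exists_blockOperator_eq_add A C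
  simp_rw [h]
  exact (((differentiableAt_const i₁).clm_comp (hB.clm_comp (differentiableAt_const p))).add
    ((differentiableAt_const i₂).clm_comp (hD.clm_comp (differentiableAt_const p)))).const_add M

/-- The upper left corners of the resolvent of an operator on `H ⊕ H'` satisfy the resolvent
equation when the upper right corners vanish. -/
theorem resolvent_equation_of_inverse_eq_blockOperator
    {S : HilbertSum H H' →L[ℂ] HilbertSum H H'} {z w : ℂ} {L₁ L₂ : H →L[ℂ] H}
    {C₁ C₂ : H →L[ℂ] H'} {D₁ D₂ : H' →L[ℂ] H'} (hz : IsUnit (z • 1 - S)) (hw : IsUnit (w • 1 - S))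
    (h₁ : Ring.inverse (z • 1 - S) = blockOperator L₁ 0 C₁ D₁)
    (h₂ : Ring.inverse (w • 1 - S) = blockOperator L₂ 0 C₂ D₂) :
    L₁ - L₂ = (w - z) • (L₁ * L₂) := by
  have key := Ring.inverse_sub_inverse (iff_of_true hz hw)
  rw [sub_sub_sub_cancel_right, h₁, h₂] at key
  have hsmul : ∀ v : HilbertSum H H',
      (w • 1 - z • 1 : HilbertSum H H' →L[ℂ] HilbertSum H H') v = (w - z) • v := fun v => by
    rw [sub_apply, smul_apply, smul_apply, one_apply_eq_self, sub_smul]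
  ext x
  have := congrArg WithLp.fst (congrArg (fun M => M (WithLp.toLp 2 (x, (0 : H')))) key)
  simp only [mul_apply_eq_comp, sub_apply, hsmul, map_smul, blockOperator_apply, map_zero,
    zero_apply, add_zero] at this
  exact this

end BlockOperator

/-! ### Shifts and diagonal operators on `ℓ²`. -/

section Shift

variable {E : Type u} [NormedAddCommGroup E]

theorem memℓp_two_iff_summable_sq {f : ℕ → E} :
    Memℓp f 2 ↔ Summable fun n => ‖f n‖ ^ 2 := by
  rw [memℓp_gen_iff (by norm_num)]
  norm_num

theorem lp.hasSum_sq_norm (f : ℓ^2(ℕ, E)) : HasSum (fun n => ‖f n‖ ^ 2) (‖f‖ ^ 2) := by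
  simpa using lp.hasSum_norm (p := 2) (by norm_num) f

theorem lp.norm_le_mul_of_tsum_sq_le {f : ℓ^2(ℕ, E)} {C : ℝ} (hC : 0 ≤ C)
    (h : ∑' n, ‖f n‖ ^ 2 ≤ C ^ 2) : ‖f‖ ≤ C :=
  lp.norm_le_of_tsum_le (by norm_num) hC (by simpa using h)

/-- The sequence `(0, x₀, x₁, …)`. -/
def consZero (f : ℕ → E) : ℕ → E
  | 0 => 0
  | n + 1 => f n

theorem memℓp_two_consZero (f : ℓ^2(ℕ, E)) : Memℓp (consZero f) 2 :=
  memℓp_two_iff_summable_sq.2 ((summable_nat_add_iff 1).1 (lp.hasSum_sq_norm f).summable)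

variable [InnerProductSpace ℂ E]

variable (E) in
/-- The backward shift `(x₀, x₁, …) ↦ (x₁, x₂, …)` on `ℓ²(ℕ, E)`. -/
noncomputable def backwardShift : ℓ^2(ℕ, E) →L[ℂ] ℓ^2(ℕ, E) :=
  LinearMap.mkContinuous
    { toFun := fun f => ⟨fun n => f (n + 1), memℓp_two_iff_summable_sq.2
        ((summable_nat_add_iff 1).2 (lp.hasSum_sq_norm f).summable)⟩
      map_add' := fun _ _ => rfl
      map_smul' := fun _ _ => rfl } 1 fun f => by
    refine lp.norm_le_mul_of_tsum_sq_le (by positivity) ?_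
    rw [one_mul, ← (lp.hasSum_sq_norm f).tsum_eq,
      (lp.hasSum_sq_norm f).summable.tsum_eq_zero_add]
    exact le_add_of_nonneg_left (by positivity)

@[simp]
theorem backwardShift_apply (f : ℓ^2(ℕ, E)) (n : ℕ) : backwardShift E f n = f (n + 1) := rfl

variable (E) in
/-- The forward shift `(x₀, x₁, …) ↦ (0, x₀, x₁, …)` on `ℓ²(ℕ, E)`. -/
noncomputable def forwardShift : ℓ^2(ℕ, E) →L[ℂ] ℓ^2(ℕ, E) :=
  LinearMap.mkContinuous
    { toFun := fun f => ⟨consZero f, memℓp_two_consZero f⟩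
      map_add' := fun f g => lp.ext (funext fun n => by
        cases n with
        | zero => exact (add_zero 0).symm
        | succ n => rfl)
      map_smul' := fun c f => by ext n; cases n <;> simp [consZero] } 1 fun f => by
    refine lp.norm_le_mul_of_tsum_sq_le (by positivity) ?_
    change ∑' n, ‖consZero f n‖ ^ 2 ≤ _
    rw [one_mul, ← (lp.hasSum_sq_norm f).tsum_eq,
      (memℓp_two_iff_summable_sq.1 (memℓp_two_consZero f)).tsum_eq_zero_add]
    simp [consZero]

@[simp]
theorem forwardShift_apply_zero (f : ℓ^2(ℕ, E)) : forwardShift E f 0 = 0 := rfl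

@[simp]
theorem forwardShift_apply_succ (f : ℓ^2(ℕ, E)) (n : ℕ) : forwardShift E f (n + 1) = f n := rfl

theorem norm_forwardShift_le : ‖forwardShift E‖ ≤ 1 :=
  LinearMap.mkContinuous_norm_le _ zero_le_one _

/-- Neumann series: the forward shift is a contraction and `|z / c| < 1`. -/
theorem isUnit_smul_one_sub_smul_forwardShift [CompleteSpace E] {z c : ℂ} (hc : ‖z‖ < ‖c‖) :
    IsUnit (c • 1 - z • forwardShift E) := by
  have hc0 : 0 < ‖c‖ := (norm_nonneg z).trans_lt hc
  have hlt : ‖(z / c) • forwardShift E‖ < 1 := by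
    rw [norm_smul, norm_div]
    exact (mul_le_of_le_one_right (by positivity) norm_forwardShift_le).trans_lt
      ((div_lt_one hc0).2 hc)
  have hcne : c ≠ 0 := norm_pos_iff.1 hc0
  have hu : IsUnit (1 - (z / c) • forwardShift E) := isUnit_one_sub_of_norm_lt_one hlt
  have h := hu.smul (Units.mk0 c hcne)
  rwa [Units.smul_mk0, smul_sub, smul_smul, mul_div_cancel₀ _ hcne] at h

theorem backwardShift_mul_forwardShift : backwardShift E * forwardShift E = 1 := by
  ext f n; simp

variable (E) in
/-- The embedding `x ↦ (x, 0, 0, …)` of `E` in `ℓ²(ℕ, E)`. -/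
noncomputable def headEmbedding : E →L[ℂ] ℓ^2(ℕ, E) :=
  lp.singleContinuousLinearMap ℂ (fun _ : ℕ => E) 2 0

@[simp]
theorem headEmbedding_apply_zero (x : E) : headEmbedding E x 0 = x := by
  simp [headEmbedding]

@[simp]
theorem headEmbedding_apply_succ (x : E) (n : ℕ) : headEmbedding E x (n + 1) = 0 := by
  simp [headEmbedding]

variable (E) in
/-- The first coordinate `(x₀, x₁, …) ↦ x₀` on `ℓ²(ℕ, E)`. -/
noncomputable def headEval : ℓ^2(ℕ, E) →L[ℂ] E :=
  lp.evalCLM ℂ (fun _ : ℕ => E) 2 0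

@[simp]
theorem headEval_apply (f : ℓ^2(ℕ, E)) : headEval E f = f 0 := rfl

theorem headEmbedding_comp_headEval_add :
    headEmbedding E ∘L headEval E + forwardShift E * backwardShift E = 1 := by
  ext f n; cases n <;> simp

variable (E) in
/-- The diagonal action `A ↦ A ⊕ A ⊕ ⋯` of operators on `E` on `ℓ²(ℕ, E)`. -/
noncomputable def ampliation : (E →L[ℂ] E) →L[ℂ] ℓ^2(ℕ, E) →L[ℂ] ℓ^2(ℕ, E) :=
  have le (A : E →L[ℂ] E) (f : ℓ^2(ℕ, E)) (n : ℕ) : ‖A (f n)‖ ^ 2 ≤ ‖A‖ ^ 2 * ‖f n‖ ^ 2 := by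
    rw [← mul_pow]; gcongr; exact A.le_opNorm _
  have summable (A : E →L[ℂ] E) (f : ℓ^2(ℕ, E)) : Summable fun n => ‖A (f n)‖ ^ 2 :=
    .of_nonneg_of_le (fun _ => by positivity) (le A f) ((lp.hasSum_sq_norm f).summable.mul_left _)
  LinearMap.mkContinuous₂
    (LinearMap.mk₂ ℂ (fun (A : E →L[ℂ] E) (f : ℓ^2(ℕ, E)) =>
        (⟨fun n => A (f n), memℓp_two_iff_summable_sq.2 (summable A f)⟩ : ℓ^2(ℕ, E)))
      (fun _ _ _ => rfl) (fun _ _ _ => rfl) (fun A f g => lp.ext (funext fun n => map_add A (f n) (g n)))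
      (fun c A f => lp.ext (funext fun n => map_smul A c (f n)))) 1 fun A f => by
    refine lp.norm_le_mul_of_tsum_sq_le (by positivity) ?_
    rw [one_mul, mul_pow, ← (lp.hasSum_sq_norm f).tsum_eq, ← tsum_mul_left]
    exact (summable A f).tsum_le_tsum (le A f) ((lp.hasSum_sq_norm f).summable.mul_left _)

@[simp]
theorem ampliation_apply (A : E →L[ℂ] E) (f : ℓ^2(ℕ, E)) (n : ℕ) :
    ampliation E A f n = A (f n) := rfl

end Shift

/-! ### The two completions of a left invertible operator. -/

section Extension

variable {H : Type u} [NormedAddCommGroup H] [InnerProductSpace ℂ H]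

/-- If `L` is a left inverse of `A` and `P = 1 - A L` is the projection onto the kernel of `L`, the
surjection `S* ⊗ P + 1 ⊗ (1 - P)` of `ℓ²(ℕ, H)`, with kernel isomorphic to the range of `P`,
completes `A` to an invertible operator. -/
theorem isUnit_and_inverse_of_complement {A L P : H →L[ℂ] H} (hLA : L * A = 1)
    (hP : P = 1 - A * L) :
    IsUnit (blockOperator A (-(P ∘L headEval H)) 0
        (backwardShift H * ampliation H P + ampliation H (1 - P))) ∧
      Ring.inverse (blockOperator A (-(P ∘L headEval H)) 0
        (backwardShift H * ampliation H P + ampliation H (1 - P))) =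
      blockOperator L 0 (-(headEmbedding H ∘L P))
        (forwardShift H * ampliation H P + ampliation H (1 - P)) := by
  have hPA : ∀ x, P (A x) = 0 := fun x => by
    have : P * A = 0 := by rw [hP, sub_mul, mul_assoc, hLA, one_mul, mul_one, sub_self]
    exact congrArg (· x) this
  have hLP : ∀ x, L (P x) = 0 := fun x => by
    have : L * P = 0 := by rw [hP, mul_sub, ← mul_assoc, hLA, one_mul, mul_one, sub_self]
    exact congrArg (· x) this
  have hPx : ∀ x, P x = x - A (L x) := fun x => by rw [hP]; rfl
  have hPP : ∀ x, P (P x) = P x := fun x => by rw [hPx (P x), hLP, map_zero, sub_zero]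
  apply blockOperator_isUnit_and_inverse hLA
  · ext x; simp [hLP]
  · ext x; simp [hPA]
  · ext x n; cases n <;> simp [hPP]
  · ext x; simp [hPP]
  · ext x; simp [hPx x, hPA]
  · ext x n; cases n <;> simp [hPP]
  · ext x n; cases n <;> simp [hPP]

/-- If `L` is a left inverse of `A` with kernel `K` and `|z| < |c|`, the operator `z - c S*`
on `ℓ²(ℕ, K)` completes `A` to an invertible operator. -/
theorem isUnit_and_inverse_of_backwardShift {A L : H →L[ℂ] H} (hLA : L * A = 1)
    {K : Submodule ℂ H} [CompleteSpace K] (hK : L.ker = K) {z c : ℂ} (hc : ‖z‖ < ‖c‖) :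
    ∃ (C : H →L[ℂ] ℓ^2(ℕ, K)) (R : ℓ^2(ℕ, K) →L[ℂ] ℓ^2(ℕ, K)),
      IsUnit (blockOperator A (-(K.subtypeL ∘L headEval K)) 0
        (z • 1 - c • backwardShift K)) ∧
      Ring.inverse (blockOperator A (-(K.subtypeL ∘L headEval K)) 0
        (z • 1 - c • backwardShift K)) = blockOperator L 0 C R := by
  have hLK : ∀ x : K, L x = 0 := fun x => hK.ge x.2
  have hAL : ∀ x, L (A x) = x := fun x => congrArg (· x) hLA
  have hPmem : ∀ x, (1 - A * L) x ∈ K := fun x => by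
    rw [← hK]
    simp [hAL]
  let P : H →L[ℂ] K := (1 - A * L).codRestrict K hPmem
  have hP : ∀ x, (P x : H) = x - A (L x) := fun x => rfl
  have hPA : ∀ x, P (A x) = 0 := fun x => Subtype.ext (by simp [hP, hAL])
  have hPK : ∀ x : K, P x = x := fun x => Subtype.ext (by simp [hP, hLK])
  obtain ⟨W, hW⟩ : IsUnit (c • 1 - z • forwardShift K) :=
    isUnit_smul_one_sub_smul_forwardShift hc
  generalize hV : (W : ℓ^2(ℕ, K) →L[ℂ] ℓ^2(ℕ, K)) = V at hW
  generalize hG : ((W⁻¹ : (ℓ^2(ℕ, K) →L[ℂ] ℓ^2(ℕ, K))ˣ) : ℓ^2(ℕ, K) →L[ℂ] ℓ^2(ℕ, K)) = G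
  have hVG : ∀ f, V (G f) = f := fun f => by
    rw [← hV, ← hG]; exact congrArg (· f) W.mul_inv
  have hGV : ∀ f, G (V f) = f := fun f => by
    rw [← hV, ← hG]; exact congrArg (· f) W.inv_mul
  have hV0 : ∀ f, V f 0 = c • f 0 := fun f => by
    rw [hW]
    change c • f 0 - z • forwardShift K f 0 = _
    simp
  have hG0 : ∀ f, c • G f 0 = f 0 := fun f => by rw [← hV0, hVG]
  have hVS : ∀ f, V (forwardShift K f) = forwardShift K (V f) := fun f => by simp [hW]
  have hGS : ∀ f, G (forwardShift K f) = forwardShift K (G f) := fun f => by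
    rw [← hGV (forwardShift K (G f)), hVS, hVG]
  -- Since `S* S = 1`, this factors the corner through the invertible `V = c - z S`. As `V` commutes
  -- with `S`, a right inverse is `-S V⁻¹`.
  have hD : z • 1 - c • backwardShift K = -(backwardShift K * V) := by
    rw [hW, mul_sub, mul_smul_comm, mul_smul_comm, backwardShift_mul_forwardShift, mul_one,
      neg_sub]
  rw [hD]
  refine ⟨-(c • (G ∘L headEmbedding K ∘L P)), -(forwardShift K * G),
    blockOperator_isUnit_and_inverse hLA ?_ ?_ ?_ ?_ ?_ ?_ ?_⟩
  · ext x; simp [hLK]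
  · ext x; simp [hPA]
  · ext x n; simp [hVG]
  · ext x; simp
  · ext x
    -- The factor `c` in `C` makes the kernel vector `c V⁻¹ (x, 0, …)` start with `x`.
    have := congrArg Subtype.val (hG0 (headEmbedding K (P x)))
    simp only [headEmbedding_apply_zero, hP, Submodule.coe_smul] at this
    simp [this]
  · ext x n; simp [hVS, hVG]
  · refine ContinuousLinearMap.ext fun f => ?_
    have := congrArg (fun M => G (M (V f))) (headEmbedding_comp_headEval_add (E := K))
    simpa [hGS, hGV, hV0, hPK] using this

end Extension

theorem theorem3p4 {H : Type u} [NormedAddCommGroup H] [InnerProductSpace ℂ H] [CompleteSpace H]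
    [TopologicalSpace.SeparableSpace H] (hH : ¬ FiniteDimensional ℂ H)
    (T : H →L[ℂ] H) (Ω : Set ℂ) (hΩo : IsOpen Ω) (hΩc : IsConnected Ω)
    (hΩ : Ω ⊆ leftResolventSet T ∩ spectrum ℂ T)
    (L : ℂ → (H →L[ℂ] H)) (hLa : AnalyticOnNhd ℂ L Ω) (hL : IsLeftInverseOn T Ω L) :
    ∃ (H' : Type u) (_ : NormedAddCommGroup H') (_ : InnerProductSpace ℂ H')
      (_ : CompleteSpace H') (Tt : ℂ → (HilbertSum H H' →L[ℂ] HilbertSum H H')),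
      (∀ z ∈ Ω, IsExtensionOf T (Tt z)) ∧
      (∀ z ∈ Ω, IsUnit (z • (1 : HilbertSum H H' →L[ℂ] HilbertSum H H') - Tt z)) ∧
      (∀ z ∈ Ω, ∃ (C : H →L[ℂ] H') (D : H' →L[ℂ] H'),
        Ring.inverse (z • (1 : HilbertSum H H' →L[ℂ] HilbertSum H H') - Tt z) =
          blockOperator (L z) 0 C D) ∧
      ((∃ T₀ : HilbertSum H H' →L[ℂ] HilbertSum H H', ∀ z ∈ Ω, Tt z = T₀) ↔
        IsLeftResolventOn T Ω L) ∧
      ((∃ z ∈ Ω, FiniteDimensional ℂ (LinearMap.ker (L z : H →ₗ[ℂ] H))) →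
        AnalyticOnNhd ℂ Tt Ω) := by
  -- Gives `‖1‖ = 1`, which the norm bound on the spectrum relies on.
  have : Nontrivial H := by
    by_contra h
    rw [not_nontrivial_iff_subsingleton] at h
    exact hH inferInstance
  have hresolvent {H' : Type u} [NormedAddCommGroup H'] [InnerProductSpace ℂ H']
      {Tt : ℂ → (HilbertSum H H' →L[ℂ] HilbertSum H H')}
      (hu : ∀ z ∈ Ω, IsUnit (z • (1 : HilbertSum H H' →L[ℂ] HilbertSum H H') - Tt z))
      (hi : ∀ z ∈ Ω, ∃ (C : H →L[ℂ] H') (D : H' →L[ℂ] H'),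
        Ring.inverse (z • (1 : HilbertSum H H' →L[ℂ] HilbertSum H H') - Tt z) =
          blockOperator (L z) 0 C D)
      (hc : ∃ T₀, ∀ z ∈ Ω, Tt z = T₀) : IsLeftResolventOn T Ω L := by
    obtain ⟨T₀, hT₀⟩ := hc
    refine ⟨hL, fun z hz w hw => ?_⟩
    replace hw := connectedComponentIn_subset _ _ hw
    obtain ⟨C₁, D₁, h₁⟩ := hi z hz
    obtain ⟨C₂, D₂, h₂⟩ := hi w hw
    have hu₁ := hu z hz
    have hu₂ := hu w hw
    rw [hT₀ z hz] at h₁ hu₁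
    rw [hT₀ w hw] at h₂ hu₂
    exact resolvent_equation_of_inverse_eq_blockOperator hu₁ hu₂ h₁ h₂
  by_cases hres : IsLeftResolventOn T Ω L
  · obtain ⟨z₀, hz₀⟩ := hΩc.nonempty
    have heq : ∀ z ∈ Ω, ∀ w ∈ Ω, L z - L w = (w - z) • (L z * L w) := fun z hz w hw =>
      hres.2 z hz w (by rwa [hΩc.isPreconnected.connectedComponentIn hz])
    -- On a vector killed by `L w`, the resolvent equation leaves only `L z x = 0`; by symmetry the
    -- kernels coincide.
    have hle : ∀ z ∈ Ω, ∀ w ∈ Ω, (L w).ker ≤ (L z).ker := fun z hz w hw x hx => by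
      have hx' : L w x = 0 := hx
      have := congrArg (· x) (heq z hz w hw)
      simpa [hx'] using this
    have hKc : CompleteSpace (L z₀).ker := (L z₀).isClosed_ker.completeSpace_coe
    -- Points of the spectrum satisfy `|z| ≤ ‖T‖`, so `c = ‖T‖ + 1` works for all of `Ω` at once.
    have hnorm : ∀ z ∈ Ω, ‖z‖ < ‖((‖T‖ + 1 : ℝ) : ℂ)‖ := fun z hz => by
      rw [Complex.norm_real, Real.norm_of_nonneg (by positivity)]
      exact (spectrum.norm_le_norm_of_mem (hΩ hz).2).trans_lt (lt_add_one _)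
    let T₀ := blockOperator T ((L z₀).ker.subtypeL ∘L headEval (L z₀).ker) 0
      (((‖T‖ + 1 : ℝ) : ℂ) • backwardShift (L z₀).ker)
    have key (z : ℂ) (hz : z ∈ Ω) : ∃ C R, IsUnit (z • 1 - T₀) ∧
        Ring.inverse (z • 1 - T₀) = blockOperator (L z) 0 C R := by
      rw [smul_one_sub_blockOperator, neg_zero]
      exact isUnit_and_inverse_of_backwardShift (hL z hz)
        (le_antisymm (hle z₀ hz₀ z hz) (hle z hz z₀ hz₀)) (hnorm z hz)
    refine ⟨ℓ^2(ℕ, (L z₀).ker), inferInstance, inferInstance, inferInstance, fun _ => T₀,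
      fun _ _ => isExtensionOf_blockOperator _ _ _, fun z hz => ?_, fun z hz => ?_,
      iff_of_true ⟨T₀, fun _ _ => rfl⟩ hres, fun _ => analyticOnNhd_const⟩
    · obtain ⟨C, R, h, -⟩ := key z hz
      exact h
    · obtain ⟨C, R, -, h⟩ := key z hz
      exact ⟨C, R, h⟩
  · let P : ℂ → (H →L[ℂ] H) := fun z => 1 - (z • 1 - T) * L z
    -- The lower right corner is `z` minus the wanted `D`, so that `z - Tt z` has exactly `D` there.
    let Tt : ℂ → (HilbertSum H ℓ^2(ℕ, H) →L[ℂ] HilbertSum H ℓ^2(ℕ, H)) := fun z =>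
      blockOperator T (P z ∘L headEval H) 0
        (z • 1 - (backwardShift H * ampliation H (P z) + ampliation H (1 - P z)))
    have key (z : ℂ) (hz : z ∈ Ω) : IsUnit (z • 1 - Tt z) ∧
        Ring.inverse (z • 1 - Tt z) = blockOperator (L z) 0 (-(headEmbedding H ∘L P z))
          (forwardShift H * ampliation H (P z) + ampliation H (1 - P z)) := by
      rw [smul_one_sub_blockOperator, neg_zero, sub_sub_cancel]
      exact isUnit_and_inverse_of_complement (hL z hz) rfl
    have hu := fun z hz => (key z hz).1
    have hi := fun z hz => (⟨_, _, (key z hz).2⟩ : ∃ C D, _ = blockOperator (L z) 0 C D)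
    refine ⟨ℓ^2(ℕ, H), inferInstance, inferInstance, inferInstance, Tt,
      fun z _ => isExtensionOf_blockOperator _ _ _, hu, hi,
      iff_of_false (fun hc => hres (hresolvent hu hi hc)) hres, fun _ => ?_⟩
    refine DifferentiableOn.analyticOnNhd (fun z hz => ?_) hΩo
    refine DifferentiableAt.differentiableWithinAt ?_
    have hLd : DifferentiableAt ℂ L z := (hLa z hz).differentiableAt
    have hPd : DifferentiableAt ℂ P z := (differentiableAt_const _).sub
      (((differentiableAt_id.smul_const _).sub_const _).mul hLd)
    refine DifferentiableAt.blockOperator (hPd.clm_comp (differentiableAt_const _)) ?_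
    refine (differentiableAt_id.smul_const _).sub ?_
    -- `ampliation` is itself bounded and linear in the operator, so it preserves differentiability.
    exact ((differentiableAt_const _).mul ((ampliation H).differentiableAt.comp z hPd)).add
      ((ampliation H).differentiableAt.comp z (hPd.const_sub 1))
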